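/- Let $n\ge 0$ and $N\ge 1$ be integers and let $\mathbf{p}=(\mathbf{p}_1,\dots,\mathbf{p}_N)$ be a configuration of $N$ (not necessarily distinct) points in Euclidean space $\mathbb{E}^n$. For real $r$ let $B_n(\mathbf{p}_i,r)$ be the closed ball of radius $r$ centered at $\mathbf{p}_i$, and put $$V_n(\mathbf{p},r)=\mathrm{Vol}_n\Big[\bigcup_{i=1}^N B_n(\mathbf{p}_i,r)\Big],\qquad V^n(\mathbf{p},r)=\mathrm{Vol}_n\Big[\bigcap_{i=1}^N B_n(\mathbf{p}_i,r)\Big].$$ Then each of $V_n(\mathbf{p},r)$ and $V^n(\mathbf{p},r)$, considered for large real $r>0$, extends to a holomorphic function of $r$ in a punctured neighborhood of infinity with a pole of order exactly $n$ at $r=\infty$. That is, for each $V\in\{V_n(\mathbf{p},\cdot),V^n(\mathbf{p},\cdot)\}$ there are $R>0$ and a function $f$, holomorphic on $\{z\in\mathbb{C}: |z|>R\}$, with $f(r)=V(r)$ for all real $r>R$, such that $s\mapsto f(1/s)$ is meromorphic at $s=0$ of order exactly $-n$ (a pole of order $n$ if $n\ge1$; a removable singularity with a nonzero value if $n=0$).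 -/

import Mathlib

open MeasureTheory Metric

/-- The volume `V_n(p, r)` of the union of the closed balls of radius `r` about the points `p i`. -/
noncomputable def unionVolume {n N : ℕ} (p : Fin N → EuclideanSpace ℝ (Fin n)) (r : ℝ) : ℝ :=
  volume.real (⋃ i, closedBall (p i) r)

/-- The volume `V^n(p, r)` of the intersection of the closed balls of radius `r` about the
points `p i`. -/
noncomputable def interVolume {n N : ℕ} (p : Fin N → EuclideanSpace ℝ (Fin n)) (r : ℝ) : ℝ :=
  volume.real (⋂ i, closedBall (p i) r)

/-- `f` has a pole of order exactly `n` at infinity: in the coordinate `s = 1 / z` it is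
meromorphic at `s = 0`, of order `-n` (for `n = 0`: a removable singularity with a nonzero
value). -/
def HasPoleOfOrderAtInfinity (f : ℂ → ℂ) (n : ℕ) : Prop :=
  MeromorphicAt (fun s : ℂ => f s⁻¹) 0 ∧
    meromorphicOrderAt (fun s : ℂ => f s⁻¹) 0 = ((-(n : ℤ) : ℤ) : WithTop ℤ)

/-- The real function `V`, restricted to large positive `r`, is holomorphic in a punctured
neighborhood `{z : ℂ | R < ‖z‖}` of infinity and has a pole of order exactly `n` there. The
extension is determined by `V`, by the identity theorem on the connected domain `R < ‖z‖`. -/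
def IsHolomorphicNearInfinityWithPole (V : ℝ → ℝ) (n : ℕ) : Prop :=
  ∃ R : ℝ, 0 < R ∧ ∃ f : ℂ → ℂ,
    DifferentiableOn ℂ f {z : ℂ | R < ‖z‖} ∧
    (∀ r : ℝ, R < r → f (r : ℂ) = (V r : ℂ)) ∧
    HasPoleOfOrderAtInfinity f n

/-!
The volume of the union is, by inclusion-exclusion, an alternating sum of volumes of intersections
of fewer balls, and these coefficients add up to `1`. So the whole theorem follows once every
intersection `⋂ i ∈ I, closedBall (p i) r` with `I` nonempty has a volume of the form
`r ^ n * h (1 / r)` for large `r`, with `h` analytic at `0` and `h 0` the volume of the unit ball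
(`hasExpansionAtInfinity_biInter_closedBall`). This is proved by strong induction on `I`, according
to an alternative from linear algebra (`exists_sphere_or_exists_affine_relation`).

* The points `p i`, `i ∈ I`, lie on a sphere with some centre `v` and radius `d`. A point `v + t • u`
  with `‖u‖ = 1` and `t > 0` lies in the ball about `p i` iff
  `t ^ 2 - 2 * t * ⟪p i - v, u⟫ + d ^ 2 ≤ r ^ 2`. Only the inner product depends on `i`, so the
  smallest one, `m u`, decides, and which index attains it does not depend on `r`. Hence the
  intersection is star-shaped about `v` with radial function `m u + √(m u ^ 2 + r ^ 2 - d ^ 2)`, and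
  polar coordinates give its volume as an integral over the fixed unit sphere of an integrand which,
  divided by `r ^ n`, is analytic in `1 / r`, uniformly in `u`.

* Otherwise there are coefficients `l i` with `∑ l i = 0`, `∑ l i • p i = 0` and
  `∑ l i * ‖p i‖ ^ 2 > 0`. Then `∑ l i * (‖x - p i‖ ^ 2 - r ^ 2)` is a positive constant, so no `x`
  lies inside all balls with `l i ≥ 0` and outside all balls with `l i < 0`. In other words the
  intersection of the balls with `l i ≥ 0` is covered by the balls with `l i < 0`, and
  inclusion-exclusion for this covering expresses the volume of the intersection of all the balls
  through intersections over proper nonempty subsets of `I`.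
-/

/-! ### Volumes in polar coordinates -/

theorem volumeIoiPow_apply_Iic (n : ℕ) (x : Set.Ioi (0 : ℝ)) :
    Measure.volumeIoiPow n (Set.Iic x) = ENNReal.ofReal (x.1 ^ (n + 1) / (n + 1)) := by
  rw [← Measure.volumeIoiPow_apply_Iio]
  apply measure_congr
  have hx : Measure.volumeIoiPow n {x} = 0 := by
    apply withDensity_absolutelyContinuous
    rw [comap_subtype_coe_apply measurableSet_Ioi]
    simp
  rw [← Set.Iio_union_right]
  exact union_ae_eq_left_of_ae_eq_empty (ae_eq_empty.2 hx)

/-- The volume in polar coordinates of a set that is star-shaped about the origin, with positive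
continuous radial function `ρ`. -/
theorem measureReal_eq_integral_toSphere_of_radial {E : Type*} [NormedAddCommGroup E]
    [NormedSpace ℝ E] [FiniteDimensional ℝ E] [Nontrivial E] [MeasurableSpace E] [BorelSpace E]
    (μ : Measure E) [μ.IsAddHaarMeasure] {K : Set E}
    {ρ : sphere (0 : E) 1 → ℝ} (hρ : Continuous ρ) (hpos : ∀ u, 0 < ρ u)
    (hKρ : ∀ (u : sphere (0 : E) 1) (t : ℝ), 0 < t → (t • (u : E) ∈ K ↔ t ≤ ρ u)) :
    μ.real K = ∫ u, ρ u ^ Module.finrank ℝ E / Module.finrank ℝ E ∂μ.toSphere := by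
  have hdim : 0 < Module.finrank ℝ E := Module.finrank_pos
  let T : Set (sphere (0 : E) 1 × Set.Ioi (0 : ℝ)) := {z | (z.2 : ℝ) ≤ ρ z.1}
  have hT : MeasurableSet T := measurableSet_le (by fun_prop) (by fun_prop)
  have hpre : homeomorphUnitSphereProd E ⁻¹' T = (↑) ⁻¹' K := by
    ext ⟨x, hx⟩
    have hx0 : 0 < ‖x‖ := norm_pos_iff.2 hx
    have h := hKρ (homeomorphUnitSphereProd E ⟨x, hx⟩).1 ‖x‖ hx0
    simp only [homeomorphUnitSphereProd_apply_fst_coe, smul_smul, mul_inv_cancel₀ hx0.ne',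
      one_smul] at h
    simp only [T, Set.mem_preimage, Set.mem_ofPred_eq, homeomorphUnitSphereProd_apply_snd_coe]
    exact h.symm
  have hμ : μ K = ∫⁻ u, ENNReal.ofReal (ρ u ^ Module.finrank ℝ E / Module.finrank ℝ E)
      ∂μ.toSphere := by
    have h1 := μ.measurePreserving_homeomorphUnitSphereProd.measure_preimage hT.nullMeasurableSet
    rw [hpre, comap_subtype_coe_apply (measurableSet_singleton _).compl,
      Subtype.image_preimage_coe, Set.inter_comm, ← Set.sdiff_eq,
      measure_sdiff_null (measure_singleton _), Measure.prod_apply hT] at h1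
    rw [h1]
    refine lintegral_congr fun u => ?_
    have : Prod.mk u ⁻¹' T = Set.Iic ⟨ρ u, hpos u⟩ := by
      ext t
      simp [T, ← Subtype.coe_le_coe]
    rw [this, volumeIoiPow_apply_Iic, Nat.sub_add_cancel hdim, ← Nat.cast_add_one,
      Nat.sub_add_cancel hdim]
  rw [measureReal_def, hμ, integral_eq_lintegral_of_nonneg_ae]
  · exact Filter.Eventually.of_forall fun u => div_nonneg (pow_nonneg (hpos u).le _) (by positivity)
  · exact (by fun_prop : Continuous _).aestronglyMeasurable

/-! ### Differentiation under the integral sign -/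

theorem hasDerivAt_integral_of_continuousOn_of_compactSpace {X : Type*} [TopologicalSpace X]
    [CompactSpace X] [MeasurableSpace X] [OpensMeasurableSpace X] [SecondCountableTopology X]
    (μ : Measure X) [IsFiniteMeasure μ] {F F' : ℂ → X → ℂ} {U : Set ℂ} (hU : IsOpen U)
    (hF : ContinuousOn (Function.uncurry F) (U ×ˢ Set.univ))
    (hF' : ContinuousOn (Function.uncurry F') (U ×ˢ Set.univ))
    (hder : ∀ x, ∀ s ∈ U, HasDerivAt (F · x) (F' s x) s) {s : ℂ} (hs : s ∈ U) :
    HasDerivAt (fun s => ∫ x, F s x ∂μ) (∫ x, F' s x ∂μ) s := by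
  have slice : ∀ {G : ℂ → X → ℂ}, ContinuousOn (Function.uncurry G) (U ×ˢ Set.univ) →
      ∀ z ∈ U, Continuous (G z) := fun hG z hz =>
    hG.comp_continuous (f := fun x => (z, x)) (by fun_prop) (by simp [hz])
  obtain ⟨ε, hε, hεU⟩ := nhds_basis_closedBall.mem_iff.1 (hU.mem_nhds hs)
  obtain ⟨C, hC⟩ := ((isCompact_closedBall s ε).prod isCompact_univ).exists_bound_of_continuousOn
    (hF'.mono (Set.prod_mono hεU subset_rfl))
  refine (hasDerivAt_integral_of_dominated_loc_of_deriv_le (bound := fun _ => C)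
    (closedBall_mem_nhds s hε) ?_ ?_ ?_ ?_ ?_ ?_).2
  · filter_upwards [hU.mem_nhds hs] with z hz
    exact (slice hF z hz).aestronglyMeasurable
  · exact (slice hF s hs).integrable_of_hasCompactSupport (HasCompactSupport.of_compactSpace _)
  · exact (slice hF' s hs).aestronglyMeasurable
  · exact .of_forall fun x z hz => hC (z, x) ⟨hz, trivial⟩
  · exact integrable_const _
  · exact .of_forall fun x z hz => hder x z (hεU hz)

/-! ### Expansions at infinity -/

/-- For large real `r`, `V r = r ^ n * h (1 / r)` with `h` analytic at `0` and `h 0 = c`. The leading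
coefficient `c` may vanish, so that the notion is linear in the pair `(V, c)`. -/
def HasExpansionAtInfinity (n : ℕ) (V : ℝ → ℝ) (c : ℝ) : Prop :=
  ∃ h : ℂ → ℂ, AnalyticAt ℂ h 0 ∧ h 0 = c ∧
    ∀ᶠ r : ℝ in Filter.atTop, (V r : ℂ) = (r : ℂ) ^ n * h (r : ℂ)⁻¹

namespace HasExpansionAtInfinity

theorem congr {n : ℕ} {V W : ℝ → ℝ} {c : ℝ} (hV : HasExpansionAtInfinity n V c)
    (hVW : V =ᶠ[Filter.atTop] W) : HasExpansionAtInfinity n W c := by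
  obtain ⟨h, ha, h0, he⟩ := hV
  refine ⟨h, ha, h0, ?_⟩
  filter_upwards [he, hVW] with r h1 h2
  rw [← h2, h1]

theorem sum {n : ℕ} {ι : Type*} {s : Finset ι} {V : ι → ℝ → ℝ} {c : ι → ℝ} (a : ι → ℝ)
    (hV : ∀ i ∈ s, HasExpansionAtInfinity n (V i) (c i)) :
    HasExpansionAtInfinity n (fun r => ∑ i ∈ s, a i * V i r) (∑ i ∈ s, a i * c i) := by
  choose! h ha h0 he using hV
  refine ⟨fun z => ∑ i ∈ s, a i * h i z, ?_, ?_, ?_⟩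
  · exact s.analyticAt_fun_sum fun i hi => analyticAt_const.mul (ha i hi)
  · push_cast
    exact Finset.sum_congr rfl fun i hi => by rw [h0 i hi]
  · filter_upwards [(Filter.eventually_all_finset s).2 he] with r hr
    push_cast
    rw [Finset.mul_sum]
    exact Finset.sum_congr rfl fun i hi => by rw [hr i hi]; ring

theorem isHolomorphicNearInfinityWithPole {n : ℕ} {V : ℝ → ℝ} {c : ℝ}
    (hV : HasExpansionAtInfinity n V c) (hc : c ≠ 0) : IsHolomorphicNearInfinityWithPole V n := by
  obtain ⟨h, ha, h0, he⟩ := hV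
  obtain ⟨ε, hε, hεU⟩ := Metric.eventually_nhds_iff_ball.1 ha.eventually_analyticAt
  obtain ⟨M, hM⟩ := Filter.eventually_atTop.1 he
  have hR : 0 < max M ε⁻¹ := lt_max_of_lt_right (inv_pos.2 hε)
  have hmer : (fun s : ℂ => s⁻¹ ^ n * h s⁻¹⁻¹) = fun s => (s - 0) ^ (-(n : ℤ)) • h s := by
    ext s
    simp
  have hmer' : MeromorphicAt (fun s : ℂ => s⁻¹ ^ n * h s⁻¹⁻¹) 0 := by
    rw [hmer]
    exact ((MeromorphicAt.id 0).sub (.const 0 0)).zpow _ |>.smul ha.meromorphicAt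
  refine ⟨max M ε⁻¹, hR, fun z => z ^ n * h z⁻¹, fun z hz => ?_, fun r hr => ?_, hmer', ?_⟩
  · have hz' : max M ε⁻¹ < ‖z‖ := hz
    have hz0 : z ≠ 0 := norm_pos_iff.1 (hR.trans hz')
    have hzε : z⁻¹ ∈ ball (0 : ℂ) ε := by
      rw [mem_ball_zero_iff, norm_inv]
      exact inv_lt_of_inv_lt₀ hε ((le_max_right _ _).trans_lt hz')
    exact ((differentiableAt_pow n).mul
      ((hεU _ hzε).differentiableAt.comp z (differentiableAt_inv hz0))).differentiableWithinAt
  · exact (hM r ((le_max_left _ _).trans hr.le)).symm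
  · rw [meromorphicOrderAt_eq_int_iff hmer']
    exact ⟨h, ha, by rw [h0]; exact_mod_cast hc, .of_forall fun s => congrFun hmer s⟩

end HasExpansionAtInfinity

/-! ### Expansions and inclusion-exclusion -/

theorem sum_powerset_nonempty_neg_one_pow {ι : Type*} {t : Finset ι}
    (ht : t.Nonempty) : ∑ u ∈ t.powerset with u.Nonempty, (-1 : ℝ) ^ (u.card + 1) = 1 := by
  classical
  have h := Finset.sum_powerset_neg_one_pow_card_of_nonempty ht
  rw [← Finset.sum_filter_add_sum_filter_not _ (fun u : Finset ι => u.Nonempty)] at h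
  have hE : t.powerset.filter (fun u : Finset ι => ¬ u.Nonempty) = {∅} := by
    ext u
    simp only [Finset.mem_filter, Finset.mem_powerset, Finset.not_nonempty_iff_eq_empty,
      Finset.mem_singleton, and_iff_right_iff_imp]
    rintro rfl
    exact Finset.empty_subset _
  rw [hE, Finset.sum_singleton, Finset.card_empty, pow_zero] at h
  have h' : ∑ u ∈ t.powerset with u.Nonempty, (-1 : ℝ) ^ u.card = -1 := by
    have : ((∑ u ∈ t.powerset with u.Nonempty, (-1 : ℤ) ^ u.card : ℤ) : ℝ) = ((-1 : ℤ) : ℝ) := by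
      congr 1
      linarith
    push_cast at this
    exact this
  simp_rw [pow_succ, ← Finset.sum_mul, h']
  norm_num

theorem HasExpansionAtInfinity.biUnion {X ι : Type*} [MeasurableSpace X] {μ : Measure X} {n : ℕ}
    {c : ℝ} {t : Finset ι} {S : ι → ℝ → Set X} (ht : t.Nonempty)
    (hS : ∀ i ∈ t, ∀ r, MeasurableSet (S i r)) (hS' : ∀ i ∈ t, ∀ r, μ (S i r) ≠ ⊤)
    (hI : ∀ u ⊆ t, u.Nonempty → HasExpansionAtInfinity n (fun r => μ.real (⋂ i ∈ u, S i r)) c) :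
    HasExpansionAtInfinity n (fun r => μ.real (⋃ i ∈ t, S i r)) c := by
  simp_rw [fun r => measureReal_biUnion_eq_sum_powerset (fun i hi => hS i hi r)
    (fun i hi => hS' i hi r)]
  have h := HasExpansionAtInfinity.sum (n := n) (s := t.powerset.filter (·.Nonempty))
    (V := fun u r => μ.real (⋂ i ∈ u, S i r)) (c := fun _ => c) (fun u => (-1) ^ (u.card + 1))
    (fun u hu => by
      simp only [Finset.mem_filter, Finset.mem_powerset] at hu
      exact hI u hu.1 hu.2)
  rwa [← Finset.sum_mul, sum_powerset_nonempty_neg_one_pow ht, one_mul] at h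

/-- The inclusion-exclusion formula, solved for the intersection of the whole family: it inherits
an expansion from the union and from the intersections of proper subfamilies. -/
theorem HasExpansionAtInfinity.biInter_of_biUnion {X ι : Type*} [MeasurableSpace X] {μ : Measure X}
    {n : ℕ} {c : ℝ} {t : Finset ι} {S : ι → ℝ → Set X} (ht : t.Nonempty)
    (hS : ∀ i ∈ t, ∀ r, MeasurableSet (S i r)) (hS' : ∀ i ∈ t, ∀ r, μ (S i r) ≠ ⊤)
    (hI : ∀ u ⊂ t, u.Nonempty → HasExpansionAtInfinity n (fun r => μ.real (⋂ i ∈ u, S i r)) c)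
    (hU : HasExpansionAtInfinity n (fun r => μ.real (⋃ i ∈ t, S i r)) c) :
    HasExpansionAtInfinity n (fun r => μ.real (⋂ i ∈ t, S i r)) c := by
  classical
  set P := t.powerset.filter (·.Nonempty) with hP
  have htP : t ∈ P := by simp [hP, ht]
  -- In the sum over `P`, the term indexed by `t` is replaced by the measure of the union; the
  -- coefficients are those of the inclusion-exclusion formula solved for the full intersection.
  let V : Finset ι → ℝ → ℝ := fun u r =>
    if u = t then μ.real (⋃ i ∈ t, S i r) else μ.real (⋂ i ∈ u, S i r)
  let a : Finset ι → ℝ := fun u =>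
    if u = t then (-1) ^ (t.card + 1) else -(-1) ^ (t.card + 1) * (-1) ^ (u.card + 1)
  have h := HasExpansionAtInfinity.sum (n := n) (s := P) (V := V) (c := fun _ => c) a
    (fun u hu => by
      simp only [hP, Finset.mem_filter, Finset.mem_powerset] at hu
      by_cases hut : u = t
      · simpa only [V, if_pos hut] using hU
      · simpa only [V, if_neg hut] using hI u (hu.1.ssubset_of_ne hut) hu.2)
  have hsq : ((-1 : ℝ) ^ (t.card + 1)) * (-1) ^ (t.card + 1) = 1 := by
    rw [← mul_pow]; simp
  have key : ∀ (b : Finset ι → ℝ) (B : ℝ), B = ∑ u ∈ P, (-1 : ℝ) ^ (u.card + 1) * b u →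
      ∑ u ∈ P, a u * (if u = t then B else b u) = b t := by
    intro b B hB
    rw [← Finset.add_sum_erase _ _ htP] at hB ⊢
    have : ∑ u ∈ P.erase t, a u * (if u = t then B else b u) =
        -(-1) ^ (t.card + 1) * ∑ u ∈ P.erase t, (-1 : ℝ) ^ (u.card + 1) * b u := by
      rw [Finset.mul_sum]
      refine Finset.sum_congr rfl fun u hu => ?_
      simp only [a, if_neg (Finset.ne_of_mem_erase hu), mul_assoc]
    rw [this]
    simp only [a, if_true]
    rw [hB]
    linear_combination b t * hsq
  have hc : ∑ u ∈ P, a u * c = c := by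
    have := key (fun _ => c) c (by
      rw [← Finset.sum_mul, sum_powerset_nonempty_neg_one_pow ht, one_mul])
    simpa using this
  rw [hc] at h
  refine h.congr (.of_forall fun r => ?_)
  exact key (fun u => μ.real (⋂ i ∈ u, S i r)) _ (measureReal_biUnion_eq_sum_powerset
    (fun i hi => hS i hi r) (fun i hi => hS' i hi r))

/-! ### The radial function in the variable `1 / r` -/

theorem one_add_sq_mul_mem_slitPlane {d m : ℝ} (hm : |m| ≤ d) {s : ℂ}
    (hs : s ∈ ball (0 : ℂ) (d + 1)⁻¹) :
    1 + s ^ 2 * ((m ^ 2 - d ^ 2 : ℝ) : ℂ) ∈ Complex.slitPlane := by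
  have hd : 0 ≤ d := (abs_nonneg m).trans hm
  have hs' : ‖s‖ * (d + 1) < 1 := by
    rw [mem_ball_zero_iff] at hs
    rwa [← lt_div_iff₀ (by linarith), one_div]
  apply Complex.mem_slitPlane_of_norm_lt_one
  have h1 : |m ^ 2 - d ^ 2| ≤ d ^ 2 := by
    rw [abs_le]
    have := sq_le_sq' (abs_le.1 hm).1 (abs_le.1 hm).2
    constructor <;> nlinarith [sq_nonneg m]
  rw [norm_mul, norm_pow, Complex.norm_real, Real.norm_eq_abs]
  calc ‖s‖ ^ 2 * |m ^ 2 - d ^ 2| ≤ ‖s‖ ^ 2 * d ^ 2 := by gcongr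
    _ ≤ (‖s‖ * (d + 1)) ^ 2 := by rw [mul_pow]; gcongr; linarith
    _ < 1 := by
      have := norm_nonneg s
      exact pow_lt_one₀ (by positivity) hs' two_ne_zero

/-- The radial function `m + √(m ^ 2 + r ^ 2 - d ^ 2)` divided by `r`, as a holomorphic function of
`s = 1 / r`, that is, `s * m + √(1 + s ^ 2 * (m ^ 2 - d ^ 2))`. The square root is `exp (log · / 2)`
with the principal logarithm; for `|m| ≤ d` its argument stays in the slit plane when
`‖s‖ < 1 / (d + 1)`. -/
noncomputable def complexRadius (d m : ℝ) (s : ℂ) : ℂ :=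
  s * m + Complex.exp (Complex.log (1 + s ^ 2 * ((m ^ 2 - d ^ 2 : ℝ) : ℂ)) / 2)

theorem complexRadius_zero (d m : ℝ) : complexRadius d m 0 = 1 := by
  simp [complexRadius]

theorem mul_complexRadius_inv {d m r : ℝ} (hd : 0 ≤ d) (hr : d < r) :
    (r : ℂ) * complexRadius d m (r : ℂ)⁻¹ = ((m + √(m ^ 2 + (r ^ 2 - d ^ 2)) : ℝ) : ℂ) := by
  have hr0 : 0 < r := hd.trans_lt hr
  have hpos : 0 < m ^ 2 + (r ^ 2 - d ^ 2) := by nlinarith [sq_nonneg m]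
  have h1 : (1 : ℂ) + (r : ℂ)⁻¹ ^ 2 * ((m ^ 2 - d ^ 2 : ℝ) : ℂ) =
      ((m ^ 2 + (r ^ 2 - d ^ 2)) / r ^ 2 : ℝ) := by
    push_cast
    have : (r : ℂ) ≠ 0 := by exact_mod_cast hr0.ne'
    field_simp
    ring
  have h2 : Complex.exp (Complex.log ((((m ^ 2 + (r ^ 2 - d ^ 2)) / r ^ 2 : ℝ)) : ℂ) / 2) =
      ((√(m ^ 2 + (r ^ 2 - d ^ 2)) / r : ℝ) : ℂ) := by
    rw [← Complex.ofReal_log (by positivity)]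
    rw [show (√(m ^ 2 + (r ^ 2 - d ^ 2)) / r) = √((m ^ 2 + (r ^ 2 - d ^ 2)) / r ^ 2) by
      rw [Real.sqrt_div hpos.le, Real.sqrt_sq hr0.le]]
    rw [Real.sqrt_eq_rpow, Real.rpow_def_of_pos (by positivity)]
    push_cast
    ring_nf
  rw [complexRadius, h1, h2]
  have : (r : ℂ) ≠ 0 := by exact_mod_cast hr0.ne'
  push_cast
  field_simp

theorem analyticAt_integral_complexRadius_pow {X : Type*} [TopologicalSpace X]
    [CompactSpace X] [MeasurableSpace X] [OpensMeasurableSpace X] [SecondCountableTopology X]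
    (μ : Measure X) [IsFiniteMeasure μ] {d : ℝ} (hd : 0 ≤ d) {m : X → ℝ} (hm : Continuous m)
    (hmd : ∀ x, |m x| ≤ d) (n : ℕ) :
    AnalyticAt ℂ (fun s => ∫ x, complexRadius d (m x) s ^ n ∂μ) 0 := by
  have hε : 0 < (d + 1)⁻¹ := by positivity
  have hcont : ContinuousOn (fun z : ℂ × X => 1 + z.1 ^ 2 * ((m z.2 ^ 2 - d ^ 2 : ℝ) : ℂ))
      (ball (0 : ℂ) (d + 1)⁻¹ ×ˢ Set.univ) := by fun_prop
  have hmem : ∀ z ∈ ball (0 : ℂ) (d + 1)⁻¹ ×ˢ (Set.univ : Set X),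
      1 + z.1 ^ 2 * ((m z.2 ^ 2 - d ^ 2 : ℝ) : ℂ) ∈ Complex.slitPlane :=
    fun z hz => one_add_sq_mul_mem_slitPlane (hmd z.2) hz.1
  have hexp : ContinuousOn (fun z : ℂ × X =>
      Complex.exp (Complex.log (1 + z.1 ^ 2 * ((m z.2 ^ 2 - d ^ 2 : ℝ) : ℂ)) / 2))
      (ball (0 : ℂ) (d + 1)⁻¹ ×ˢ Set.univ) :=
    Complex.continuous_exp.comp_continuousOn ((hcont.clog hmem).div_const 2)
  have hrad : ContinuousOn (fun z : ℂ × X => complexRadius d (m z.2) z.1)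
      (ball (0 : ℂ) (d + 1)⁻¹ ×ˢ Set.univ) :=
    ContinuousOn.add (by fun_prop) hexp
  let F' : ℂ → X → ℂ := fun s x => n * complexRadius d (m x) s ^ (n - 1) *
    (m x + Complex.exp (Complex.log (1 + s ^ 2 * ((m x ^ 2 - d ^ 2 : ℝ) : ℂ)) / 2) *
      (2 * s * ((m x ^ 2 - d ^ 2 : ℝ) : ℂ) / (1 + s ^ 2 * ((m x ^ 2 - d ^ 2 : ℝ) : ℂ)) / 2))
  have hdiff : DifferentiableOn ℂ (fun s => ∫ x, complexRadius d (m x) s ^ n ∂μ)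
      (ball 0 (d + 1)⁻¹) := fun s hs =>
    (hasDerivAt_integral_of_continuousOn_of_compactSpace μ
      (F := fun s x => complexRadius d (m x) s ^ n) (F' := F') isOpen_ball (hrad.pow n)
      (((hrad.pow (n - 1)).const_mul (n : ℂ)).mul
        (ContinuousOn.add (by fun_prop) (hexp.mul
          ((ContinuousOn.div (by fun_prop) hcont
            fun z hz => Complex.slitPlane_ne_zero (hmem z hz)).div_const 2))))
      (fun x s hs => by
        have h1 : HasDerivAt (fun s : ℂ => 1 + s ^ 2 * ((m x ^ 2 - d ^ 2 : ℝ) : ℂ))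
            (2 * s * ((m x ^ 2 - d ^ 2 : ℝ) : ℂ)) s := by
          simpa using ((hasDerivAt_pow 2 s).mul_const _).const_add 1
        have h2 := ((h1.clog (one_add_sq_mul_mem_slitPlane (hmd x) hs)).div_const 2).cexp
        have h3 := (((hasDerivAt_id s).mul_const (m x : ℂ)).add h2).pow n
        refine HasDerivAt.congr_deriv h3 ?_
        simp [F', complexRadius]) hs).differentiableAt.differentiableWithinAt
  exact hdiff.analyticAt (ball_mem_nhds _ hε)

/-! ### Intersections of balls -/

section InnerProductSpace

variable {E : Type*} [NormedAddCommGroup E] [InnerProductSpace ℝ E]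

/-- If the centres `q i` lie on a sphere of radius `d < r` about the origin, then along the ray of `u`
the intersection of the balls is determined by the smallest inner product of `u` with a `q i`. -/
theorem smul_mem_biInter_closedBall_iff {ι : Type*} {I : Finset ι} (hI : I.Nonempty) {q : ι → E}
    {d r : ℝ} (hd : 0 ≤ d) (hr : d < r) (hq : ∀ i ∈ I, ‖q i‖ = d) {u : E} (hu : ‖u‖ = 1) {t : ℝ}
    (ht : 0 < t) :
    t • u ∈ ⋂ i ∈ I, closedBall (q i) r ↔
      t ≤ I.inf' hI (fun i => inner ℝ (q i) u) +
        √((I.inf' hI fun i => inner ℝ (q i) u) ^ 2 + (r ^ 2 - d ^ 2)) := by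
  have hr0 : 0 < r := hd.trans_lt hr
  have h1 : ∀ i ∈ I, t • u ∈ closedBall (q i) r ↔
      (t ^ 2 + d ^ 2 - r ^ 2) / (2 * t) ≤ inner ℝ (q i) u := fun i hi => by
    have hn : ‖t • u - q i‖ ^ 2 = t ^ 2 - 2 * t * inner ℝ (q i) u + d ^ 2 := by
      rw [norm_sub_sq_real, norm_smul, hu, hq i hi, real_inner_smul_left, real_inner_comm,
        Real.norm_eq_abs, mul_one, sq_abs]
      ring
    rw [mem_closedBall, dist_eq_norm, ← sq_le_sq₀ (norm_nonneg _) hr0.le, hn,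
      div_le_iff₀ (by positivity)]
    constructor <;> intro h <;> linarith
  rw [Set.mem_iInter₂]
  set M := I.inf' hI fun i => inner ℝ (q i) u
  have h2 : (∀ i ∈ I, t • u ∈ closedBall (q i) r) ↔ (t ^ 2 + d ^ 2 - r ^ 2) / (2 * t) ≤ M := by
    rw [Finset.le_inf'_iff]
    exact forall₂_congr h1
  rw [h2, div_le_iff₀ (by positivity), ← sub_le_iff_le_add']
  have hpos : 0 < r ^ 2 - d ^ 2 := by nlinarith
  constructor
  · intro h
    exact Real.le_sqrt_of_sq_le (by nlinarith)
  · intro h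
    by_cases htM : 0 ≤ t - M
    · have := (Real.le_sqrt htM (by positivity)).1 h
      nlinarith
    · nlinarith

/-- The equation `‖p i - v‖ = d` for all `i` amounts to `‖p i‖ ^ 2 = 2 * ⟪p i, v⟫ + c` with
`c = d ^ 2 - ‖v‖ ^ 2`, which is linear in `(v, c)`. If it has no solution, a functional vanishing on
the range of the linear map but not on `(‖p i‖ ^ 2)` gives the coefficients `l`. -/
theorem exists_sphere_or_exists_affine_relation {ι : Type*} (I : Finset ι) (p : ι → E) :
    (∃ (v : E) (d : ℝ), ∀ i ∈ I, ‖p i - v‖ = d) ∨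
      ∃ l : ι → ℝ, ∑ i ∈ I, l i = 0 ∧ ∑ i ∈ I, l i • p i = 0 ∧ 0 < ∑ i ∈ I, l i * ‖p i‖ ^ 2 := by
  classical
  let L : E × ℝ →ₗ[ℝ] (I → ℝ) := LinearMap.pi fun i =>
    (((2 : ℝ) • innerₛₗ ℝ (p i)).comp (LinearMap.fst ℝ E ℝ)) + LinearMap.snd ℝ E ℝ
  have hL : ∀ v c (i : I), L (v, c) i = 2 * inner ℝ (p i) v + c := fun v c i => by simp [L]
  by_cases h : (fun i : I => ‖p i‖ ^ 2) ∈ LinearMap.range L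
  · left
    obtain ⟨⟨v, c⟩, hv⟩ := h
    refine ⟨v, √(c + ‖v‖ ^ 2), fun i hi => ?_⟩
    have := congrFun hv ⟨i, hi⟩
    rw [hL] at this
    rw [← Real.sqrt_sq (norm_nonneg (p i - v)), norm_sub_sq_real, ← this]
    congr 1
    ring
  · right
    obtain ⟨f, hf, hker⟩ := Submodule.exists_le_ker_of_notMem h
    have hfx : ∀ x : I → ℝ, f x = ∑ i ∈ I.attach, f (Pi.single i 1) * x i := fun x => by
      rw [LinearMap.pi_apply_eq_sum_univ f x]
      simp only [smul_eq_mul, Finset.univ_eq_attach]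
      refine Finset.sum_congr rfl fun i _ => ?_
      rw [mul_comm]
      congr 2
      ext j
      simp [Pi.single_apply, eq_comm]
    have hrel : ∀ v c, ∑ i ∈ I.attach, f (Pi.single i 1) * (2 * inner ℝ (p i) v + c) = 0 :=
      fun v c => by
        have := hker (LinearMap.mem_range_self L (v, c))
        rw [LinearMap.mem_ker, hfx] at this
        simpa only [hL] using this
    -- Multiplying the coefficients of `f` by this nonzero scalar makes the last sum a square.
    let σ : ℝ := f fun i : I => ‖p i‖ ^ 2
    let l : ι → ℝ := fun i => if hi : i ∈ I then σ * f (Pi.single ⟨i, hi⟩ 1) else 0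
    have hl : ∀ i : I, l i = σ * f (Pi.single i 1) := fun i => by simp [l]
    refine ⟨l, ?_, ?_, ?_⟩
    · rw [← Finset.sum_attach]
      simp_rw [hl, ← Finset.mul_sum]
      simpa using Or.inr (hrel 0 1)
    · refine ext_inner_right ℝ fun v => ?_
      rw [inner_zero_left, ← Finset.sum_attach, sum_inner]
      simp_rw [real_inner_smul_left, hl, mul_assoc, ← Finset.mul_sum]
      have := hrel v 0
      simp_rw [add_zero, mul_left_comm _ (2 : ℝ), ← Finset.mul_sum] at this
      rw [(mul_eq_zero.1 this).resolve_left two_ne_zero, mul_zero]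
    · rw [← Finset.sum_attach]
      simp_rw [hl, mul_assoc, ← Finset.mul_sum]
      rw [← hfx fun i : I => ‖p i‖ ^ 2]
      exact mul_self_pos.2 hf

theorem sum_mul_norm_sub_sq_of_affine_relation {ι : Type*} {I : Finset ι} {p : ι → E} {l : ι → ℝ}
    (h0 : ∑ i ∈ I, l i = 0) (h1 : ∑ i ∈ I, l i • p i = 0) (x : E) :
    ∑ i ∈ I, l i * ‖x - p i‖ ^ 2 = ∑ i ∈ I, l i * ‖p i‖ ^ 2 := by
  have h2 : ∑ i ∈ I, l i * inner ℝ x (p i) = 0 := by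
    simp_rw [← real_inner_smul_right, ← inner_sum, h1, inner_zero_right]
  simp_rw [norm_sub_sq_real]
  have : ∀ i, l i * (‖x‖ ^ 2 - 2 * inner ℝ x (p i) + ‖p i‖ ^ 2) =
      l i * ‖x‖ ^ 2 - 2 * (l i * inner ℝ x (p i)) + l i * ‖p i‖ ^ 2 := fun i => by ring
  simp_rw [this, Finset.sum_add_distrib, Finset.sum_sub_distrib, ← Finset.sum_mul,
    ← Finset.mul_sum, h0, h2]
  ring

variable [FiniteDimensional ℝ E] [MeasurableSpace E] [BorelSpace E] (μ : Measure E)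
  [μ.IsAddHaarMeasure]

theorem hasExpansionAtInfinity_biInter_closedBall_of_sphere {ι : Type*} {I : Finset ι}
    (hI : I.Nonempty) {p : ι → E} {v : E} {d : ℝ} (hp : ∀ i ∈ I, ‖p i - v‖ = d) :
    HasExpansionAtInfinity (Module.finrank ℝ E) (fun r => μ.real (⋂ i ∈ I, closedBall (p i) r))
      (μ.real (ball 0 1)) := by
  obtain ⟨i₀, hi₀⟩ := hI
  have hd : 0 ≤ d := hp i₀ hi₀ ▸ norm_nonneg _
  rcases subsingleton_or_nontrivial E with hE | hE
  -- In dimension `0` every ball of positive radius is the whole space.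
  · refine ⟨fun _ => μ.real (ball 0 1), analyticAt_const, rfl, ?_⟩
    filter_upwards [Filter.eventually_gt_atTop 0] with r hr
    have h1 : ⋂ i ∈ I, closedBall (p i) r = Set.univ := by
      ext x
      simp [Subsingleton.elim _ x, hr.le]
    have h2 : ball (0 : E) 1 = Set.univ := by
      ext x
      simp [Subsingleton.elim x 0]
    simp [h1, h2, Module.finrank_zero_of_subsingleton]
  have hI : I.Nonempty := ⟨i₀, hi₀⟩
  let m : sphere (0 : E) 1 → ℝ := fun u => I.inf' hI fun i => inner ℝ (p i - v) (u : E)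
  have hm : Continuous m := Continuous.finset_inf'_apply hI fun i _ => by fun_prop
  have hmd : ∀ u, |m u| ≤ d := fun u => by
    obtain ⟨i, hi, h⟩ := I.exists_mem_eq_inf' hI fun i => inner ℝ (p i - v) (u : E)
    simp only [m]
    rw [h]
    simpa [hp i hi] using abs_real_inner_le_norm (p i - v) (u : E)
  set n := Module.finrank ℝ E with hn
  have hn0 : (n : ℂ) ≠ 0 := by exact_mod_cast (Module.finrank_pos (R := ℝ) (M := E)).ne'
  refine ⟨fun s => (∫ u, complexRadius d (m u) s ^ n ∂μ.toSphere) / n, ?_, ?_, ?_⟩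
  · exact (analyticAt_integral_complexRadius_pow _ hd hm hmd n).div_const
  · simp [complexRadius_zero, ← hn, hn0]
  · filter_upwards [Filter.eventually_gt_atTop d] with r hr
    have hpos : 0 < r ^ 2 - d ^ 2 := by nlinarith
    have htrans : μ.real (⋂ i ∈ I, closedBall (p i) r) =
        μ.real (⋂ i ∈ I, closedBall (p i - v) r) := by
      rw [measureReal_def, measureReal_def, ← measure_preimage_add μ v]
      congr 2
      ext x
      simp [dist_eq_norm, sub_sub_eq_add_sub, add_comm]
    rw [htrans, measureReal_eq_integral_toSphere_of_radial μ
      (ρ := fun u => m u + √(m u ^ 2 + (r ^ 2 - d ^ 2))) (by fun_prop) ?_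
      (fun u t ht => smul_mem_biInter_closedBall_iff hI hd hr hp (by simp) ht)]
    · rw [integral_div, Complex.ofReal_div, ← integral_complex_ofReal, Complex.ofReal_natCast,
        ← mul_div_assoc, ← integral_const_mul]
      congr 2
      ext u
      rw [← mul_pow, mul_complexRadius_inv hd hr, Complex.ofReal_pow]
    · intro u
      have : |m u| < √(m u ^ 2 + (r ^ 2 - d ^ 2)) :=
        Real.lt_sqrt_of_sq_lt (by rw [sq_abs]; linarith)
      linarith [neg_abs_le (m u)]

theorem hasExpansionAtInfinity_biInter_closedBall {ι : Type*} (p : ι → E) (I : Finset ι)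
    (hI : I.Nonempty) :
    HasExpansionAtInfinity (Module.finrank ℝ E) (fun r => μ.real (⋂ i ∈ I, closedBall (p i) r))
      (μ.real (ball 0 1)) := by
  classical
  induction I using Finset.strongInduction with
  | H I ih =>
    rcases exists_sphere_or_exists_affine_relation I p with ⟨v, d, h⟩ | ⟨l, h0, h1, h2⟩
    · exact hasExpansionAtInfinity_biInter_closedBall_of_sphere μ hI h
    -- By the affine relation, the balls over `J` cover the intersection of the balls over `K`.
    set J := I.filter (l · < 0) with hJ
    set K := I.filter (0 ≤ l ·) with hK
    have hunion : ∀ u : Finset ι, u.Nonempty → ∀ r, ⋂ i ∈ u, (closedBall (p i) r ∩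
        ⋂ j ∈ K, closedBall (p j) r) = ⋂ i ∈ u ∪ K, closedBall (p i) r := fun u ⟨i₀, hi₀⟩ r => by
      ext x
      simp only [Set.mem_iInter, Set.mem_inter_iff, Finset.mem_union]
      grind
    have hne : ∃ i ∈ I, l i ≠ 0 := by
      by_contra! h
      rw [Finset.sum_eq_zero fun i hi => by rw [h i hi, zero_mul]] at h2
      exact h2.false
    have hJne : J.Nonempty := by
      by_contra hJ'
      have hnn : ∀ i ∈ I, 0 ≤ l i := by simpa [hJ, Finset.filter_eq_empty_iff] using hJ'
      obtain ⟨i, hi, hli⟩ := hne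
      exact hli ((Finset.sum_eq_zero_iff_of_nonneg hnn).1 h0 i hi)
    have hKne : K.Nonempty := by
      by_contra hK'
      have hneg : ∀ i ∈ I, l i < 0 := by simpa [hK, Finset.filter_eq_empty_iff] using hK'
      exact (Finset.sum_neg hneg hI).ne h0
    have hJK : J ∪ K = I := by
      ext i
      simp only [hJ, hK, Finset.mem_union, Finset.mem_filter]
      grind
    have hcover : ∀ r > 0, ⋂ j ∈ K, closedBall (p j) r =
        ⋃ i ∈ J, (closedBall (p i) r ∩ ⋂ j ∈ K, closedBall (p j) r) := fun r hr => by
      rw [← Set.iUnion₂_inter, eq_comm, Set.inter_eq_right]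
      intro x hx
      by_contra hxJ
      simp only [Set.mem_iUnion, not_exists, mem_closedBall, not_le, Set.mem_iInter,
        dist_eq_norm] at hx hxJ
      have hle : ∑ i ∈ I, l i * (‖x - p i‖ ^ 2 - r ^ 2) ≤ 0 := by
        refine Finset.sum_nonpos fun i hi => ?_
        rcases lt_or_ge (l i) 0 with hli | hli
        · have := hxJ i (by simp [hJ, hi, hli])
          exact mul_nonpos_of_nonpos_of_nonneg hli.le (by nlinarith)
        · have := hx i (by simp [hK, hi, hli])
          exact mul_nonpos_of_nonneg_of_nonpos hli (by nlinarith [norm_nonneg (x - p i)])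
      simp_rw [mul_sub, Finset.sum_sub_distrib, ← Finset.sum_mul, h0, zero_mul, sub_zero,
        sum_mul_norm_sub_sq_of_affine_relation h0 h1] at hle
      exact h2.not_ge hle
    have hKI : K ⊂ I := by
      obtain ⟨i, hi⟩ := hJne
      simp only [hJ, Finset.mem_filter] at hi
      exact Finset.filter_ssubset.2 ⟨i, hi.1, not_le.2 hi.2⟩
    have hmain := HasExpansionAtInfinity.biInter_of_biUnion (μ := μ)
      (n := Module.finrank ℝ E) (c := μ.real (ball 0 1))
      (S := fun i r => closedBall (p i) r ∩ ⋂ j ∈ K, closedBall (p j) r) hJne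
      (fun i _ r => measurableSet_closedBall.inter
        (K.measurableSet_biInter fun _ _ => measurableSet_closedBall))
      (fun i _ r => measure_ne_top_of_subset Set.inter_subset_left measure_closedBall_lt_top.ne)
      (fun u huJ hu => by
        simp_rw [hunion u hu]
        refine ih _ ?_ (hu.mono Finset.subset_union_left)
        obtain ⟨j, hjJ, hju⟩ := Finset.exists_of_ssubset huJ
        refine (Finset.ssubset_iff_of_subset ?_).2 ⟨j, hJK ▸ Finset.mem_union_left _ hjJ, ?_⟩
        · rw [← hJK]
          exact Finset.union_subset_union huJ.subset subset_rfl
        · simp only [hJ, hK, Finset.mem_filter, Finset.mem_union, not_or] at hjJ ⊢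
          exact ⟨hju, fun h => absurd h.2 (not_le.2 hjJ.2)⟩)
      ((ih K hKI hKne).congr (by
        filter_upwards [Filter.eventually_gt_atTop 0] with r hr
        rw [← hcover r hr]))
    simp_rw [hunion J hJne, hJK] at hmain
    exact hmain

end InnerProductSpace

/-! ### Unions and intersections of all the balls -/

theorem mainTheorem6 (n N : ℕ) (hN : 0 < N) (p : Fin N → EuclideanSpace ℝ (Fin n)) :
    IsHolomorphicNearInfinityWithPole (unionVolume p) n ∧
      IsHolomorphicNearInfinityWithPole (interVolume p) n := by
  have hne : (Finset.univ : Finset (Fin N)).Nonempty := ⟨⟨0, hN⟩, Finset.mem_univ _⟩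
  have hc : volume.real (ball (0 : EuclideanSpace ℝ (Fin n)) 1) ≠ 0 :=
    (ENNReal.toReal_pos (measure_ball_pos _ _ one_pos).ne' measure_ball_lt_top.ne).ne'
  have hinter := hasExpansionAtInfinity_biInter_closedBall
    (volume : Measure (EuclideanSpace ℝ (Fin n))) p
  rw [finrank_euclideanSpace_fin] at hinter
  have hU := HasExpansionAtInfinity.biUnion (S := fun i r => closedBall (p i) r) hne
    (fun _ _ _ => measurableSet_closedBall) (fun _ _ _ => measure_closedBall_lt_top.ne)
    (fun u _ hu => hinter u hu)
  have hI := hinter Finset.univ hne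
  simp only [Finset.mem_univ, Set.iUnion_true, Set.iInter_true] at hU hI
  exact ⟨hU.isHolomorphicNearInfinityWithPole hc, hI.isHolomorphicNearInfinityWithPole hc⟩
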